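/- Let $T$ be a complete first-order theory in a language $\tau$, let $\bar\kappa>|T|$ be a strongly inaccessible cardinal, and let $\mathfrak C$ be a $\bar\kappa$-saturated model of $T$. Let $A_*\subseteq\mathfrak C$ with $|A_*|<\bar\kappa$, let $p_*(x)$ be a $1$-type over $A_*$, and let $*$, ${}^{-1}$, $e_G$ be a binary function, a unary function and an element, all first-order definable in $\mathfrak C$ with parameters from $A_*$, whose restrictions to $p_*(\mathfrak C)=\{c\in\mathfrak C: c\text{ realizes }p_*\}$ make it a group $G$. For $n<\omega$, an ordinal $\alpha<\bar\kappa$ and a tuple $\bar a\in{}^{\alpha}\mathfrak C$, let $q^n_{\bar a}(x)$ be the set of all formulas $$(\exists y_0,\dots,y_{2n-1})\Big[\bigwedge_{\ell<2n}\psi(y_\ell)\ \wedge\bigwedge_{\ell<n,\,k<m}\big(\varphi_k(y_{2\ell},\bar a)\leftrightarrow\varphi_k(y_{2\ell+1},\bar a)\big)\ \wedge\ x=(y_0^{-1}*y_1)*\cdots*(y_{2n-2}^{-1}*y_{2n-1})\Big],$$ where $\psi$ is a finite conjunction of members of $p_*$, $m<\omega$, and $\varphi_k(x,\bar y)$ $(k<m)$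 are first-order formulas of $\tau$ (for $n=0$ the product is $e_G$); write $q^n_{\bar a}(\mathfrak C)$ for its set of realizations in $\mathfrak C$. Assume that $T$ is dependent (no formula $\varphi(\bar x,\bar y)$ has the independence property) and that $G$ is abelian. If $k(1)+2<k(2)<\omega$ and $\alpha<\bar\kappa$ is an ordinal, then there are a cardinal $\lambda<\bar\kappa$ and tuples $\bar a_\varepsilon\in{}^{\alpha}\mathfrak C$ $(\varepsilon<\lambda)$ such that for every $\bar a\in{}^{\alpha}\mathfrak C$ with $A_*\subseteq\operatorname{Rang}(\bar a)$ we have $$\bigcap_{\varepsilon<\lambda}q^{k(1)}_{\bar a_\varepsilon}(\mathfrak C)\subseteq q^{k(2)}_{\bar a}(\mathfrak C),\qquad\text{i.e.}\qquad\bigcup_{\varepsilon<\lambda}q^{k(1)}_{\bar a_\varepsilon}\vdash q^{k(2)}_{\bar a},$$ where $p\vdash q$ means that each formula of $q$ follows in $\mathfrak C$ from finitely many formulas of $p$. (An intersection over the empty index set is $\mathfrak C$.) -/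

import Mathlib

open FirstOrder FirstOrder.Language Cardinal

universe u v w

namespace ShelahDep

/-! ### Types, saturation, dependence -/

section ModelTheory

variable (L : FirstOrder.Language.{u, v}) (M : Type w)

/-- Formulas `φ(x, b)` in one free variable `x` with parameters `b` from `M`: the variables
`Sum.inl b` are the parameters, `Sum.inr ()` is the variable `x`. -/
abbrev ParamFormula := L.Formula (M ⊕ Unit)

variable {L M} [L.Structure M]

/-- The element `c` satisfies the formula `φ(x, b)`, each parameter being interpreted as itself. -/
def Holds (φ : ParamFormula L M) (c : M) : Prop :=
  φ.Realize (Sum.elim id fun _ => c)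

/-- `p(𝔐)`, the set of elements realizing all formulas of `p`. -/
def solutions (p : Set (ParamFormula L M)) : Set M :=
  {c | ∀ φ ∈ p, Holds φ c}

/-- `p ⊢ q` over the elementary diagram of `M`: each formula of `q` follows in `M` from finitely
many formulas of `p`. -/
def Entails (p q : Set (ParamFormula L M)) : Prop :=
  ∀ φ ∈ q, ∃ s : Finset (ParamFormula L M), (s : Set (ParamFormula L M)) ⊆ p ∧
    ∀ c : M, (∀ ψ ∈ s, Holds ψ c) → Holds φ c

/-- A formula with parameters from `A`, seen as a formula with parameters from `M`. -/
def liftParams {A : Set M} (φ : L.Formula (A ⊕ Unit)) : ParamFormula L M :=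
  φ.relabel (Sum.map (fun a : A => (a : M)) id)

variable (L M) in
/-- `M` is `κ`-saturated: every finitely satisfiable set of formulas in one variable over a
parameter set of cardinality `< κ` is realized in `M`. -/
def IsSaturated (κ : Cardinal.{w}) : Prop :=
  ∀ A : Set M, #A < κ → ∀ p : Set (L.Formula (A ⊕ Unit)),
    (∀ s : Finset (L.Formula (A ⊕ Unit)), (s : Set (L.Formula (A ⊕ Unit))) ⊆ p →
      ∃ c : M, ∀ φ ∈ s, Holds (liftParams φ) c) →
    ∃ c : M, ∀ φ ∈ p, Holds (liftParams φ) c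

variable (M) in
/-- The formula `φ(x̄, ȳ)` has the independence property in `M`: for every `N` there are tuples
`a i` (`i < N`) and `b s` (`s ⊆ N`) such that `φ(a i, b s)` holds iff `i ∈ s`. -/
def HasIP {m n : ℕ} (φ : L.Formula (Fin m ⊕ Fin n)) : Prop :=
  ∀ N : ℕ, ∃ (a : Fin N → Fin m → M) (b : Set (Fin N) → Fin n → M),
    ∀ (i : Fin N) (s : Set (Fin N)), φ.Realize (Sum.elim (a i) (b s)) ↔ i ∈ s

/-- `T` is dependent: no formula has the independence property in a model of `T`.  (For a complete
theory the choice of the model is immaterial.) -/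
def IsDependent (T : L.Theory) : Prop :=
  ∀ (N : Type w) [L.Structure N] [Nonempty N], N ⊨ T →
    ∀ (m n : ℕ) (φ : L.Formula (Fin m ⊕ Fin n)), ¬ HasIP N φ

end ModelTheory

/-! ### Type-definable groups -/

/-- A group whose universe is the solution set of a 1-type `p` over the set `params`, with
operations that are restrictions of functions on `M` definable by formulas over `params`. -/
structure TypeDefGroup (L : FirstOrder.Language.{u, v}) (M : Type w) [L.Structure M] where
  /-- the parameter set `A_*` -/
  params : Set M
  /-- the type `p_*(x)` -/
  p : Set (L.Formula (params ⊕ Unit))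
  mul : M → M → M
  inv : M → M
  one : M
  /-- a formula `μ(x, y, z)` defining `x * y = z` -/
  mulF : L.Formula (params ⊕ Fin 3)
  /-- a formula `ι(x, z)` defining `x⁻¹ = z` -/
  invF : L.Formula (params ⊕ Fin 2)
  /-- a formula `η(z)` defining `e = z` -/
  oneF : L.Formula (params ⊕ Fin 1)
  realize_mulF : ∀ x y z : M, mulF.Realize (Sum.elim (fun a : params => (a : M)) ![x, y, z]) ↔ mul x y = z
  realize_invF : ∀ x z : M, invF.Realize (Sum.elim (fun a : params => (a : M)) ![x, z]) ↔ inv x = z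
  realize_oneF : ∀ z : M, oneF.Realize (Sum.elim (fun a : params => (a : M)) ![z]) ↔ one = z
  mul_mem : ∀ x ∈ solutions (liftParams '' p), ∀ y ∈ solutions (liftParams '' p),
    mul x y ∈ solutions (liftParams '' p)
  inv_mem : ∀ x ∈ solutions (liftParams '' p), inv x ∈ solutions (liftParams '' p)
  one_mem : one ∈ solutions (liftParams '' p)
  mul_assoc : ∀ x ∈ solutions (liftParams '' p), ∀ y ∈ solutions (liftParams '' p),
    ∀ z ∈ solutions (liftParams '' p), mul (mul x y) z = mul x (mul y z)
  one_mul : ∀ x ∈ solutions (liftParams '' p), mul one x = x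
  mul_one : ∀ x ∈ solutions (liftParams '' p), mul x one = x
  inv_mul : ∀ x ∈ solutions (liftParams '' p), mul (inv x) x = one
  mul_inv : ∀ x ∈ solutions (liftParams '' p), mul x (inv x) = one

namespace TypeDefGroup

variable {L : FirstOrder.Language.{u, v}} {M : Type w} [L.Structure M] (G : TypeDefGroup L M)

/-- The type `p_*` as a set of formulas with parameters in `M`. -/
def pM : Set (ParamFormula L M) := liftParams '' G.p

/-- The underlying set `p_*(𝔐)` of the group. -/
def carrier : Set M := solutions G.pM

/-- The group is abelian. -/
def IsAbelian : Prop := ∀ x ∈ G.carrier, ∀ y ∈ G.carrier, G.mul x y = G.mul y x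

/-- The product `c₀ * c₁ * ⋯ * c_{n-1}` of a list, which is `e` for the empty list. -/
def listProd : List M → M
  | [] => G.one
  | c :: cs => cs.foldl G.mul c

/-! A formula `F(v, z)` (`v` ranging over variables in `V`, `z` a further variable) may define a
function `v ↦ z`.  The next definitions compose such formulas with the group operations. The map
`par` says which variables in `V` stand for the parameters. -/

section Formulas

variable {V : Type*} (par : M → V)

/-- `z = v_i` -/
def varG (i : V) : L.Formula (V ⊕ Unit) :=
  Term.equal (Term.var (Sum.inl i)) (Term.var (Sum.inr ()))

/-- `z = e` -/
def oneG : L.Formula (V ⊕ Unit) :=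
  G.oneF.relabel (Sum.elim (fun a : G.params => Sum.inl (par a)) fun _ => Sum.inr ())

/-- `∃ t, F(v, t) ∧ z = t⁻¹` -/
noncomputable def invG (F : L.Formula (V ⊕ Unit)) : L.Formula (V ⊕ Unit) :=
  Formula.iExs (Fin 1)
    (F.relabel (Sum.elim (fun i => Sum.inl (Sum.inl i)) fun _ => Sum.inr 0) ⊓
      G.invF.relabel (Sum.elim (fun a : G.params => Sum.inl (Sum.inl (par a)))
        ![Sum.inr 0, Sum.inl (Sum.inr ())]))

/-- `∃ s t, F₁(v, s) ∧ F₂(v, t) ∧ z = s * t` -/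
noncomputable def mulG (F₁ F₂ : L.Formula (V ⊕ Unit)) : L.Formula (V ⊕ Unit) :=
  Formula.iExs (Fin 2)
    (F₁.relabel (Sum.elim (fun i => Sum.inl (Sum.inl i)) fun _ => Sum.inr 0) ⊓
      (F₂.relabel (Sum.elim (fun i => Sum.inl (Sum.inl i)) fun _ => Sum.inr 1) ⊓
        G.mulF.relabel (Sum.elim (fun a : G.params => Sum.inl (Sum.inl (par a)))
          ![Sum.inr 0, Sum.inr 1, Sum.inl (Sum.inr ())])))

/-- `z` is the product of the values defined by the formulas of a list. -/
noncomputable def listProdG : List (L.Formula (V ⊕ Unit)) → L.Formula (V ⊕ Unit)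
  | [] => G.oneG par
  | F :: Fs => Fs.foldl (G.mulG par) F

/-- At the assignment `v`, the formula `F` defines the value `c`. -/
def Defines (F : L.Formula (V ⊕ Unit)) (v : V → M) (c : M) : Prop :=
  ∀ z : M, F.Realize (Sum.elim v fun _ => z) ↔ c = z

theorem defines_varG (v : V → M) (i : V) : Defines (varG (L := L) i) v (v i) := by
  intro z
  simp [varG]

theorem defines_oneG {v : V → M} (hv : ∀ a, v (par a) = a) : Defines (G.oneG par) v G.one := by
  intro z
  rw [oneG, Formula.realize_relabel, ← G.realize_oneF]
  refine iff_of_eq (congrArg _ (funext ?_))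
  rintro (a | i)
  · simp [hv]
  · fin_cases i; rfl

theorem defines_invG {v : V → M} (hv : ∀ a, v (par a) = a) {F : L.Formula (V ⊕ Unit)} {c : M}
    (hF : Defines F v c) : Defines (G.invG par F) v (G.inv c) := by
  intro z
  have h1 : ∀ t : Fin 1 → M, (Sum.elim (Sum.elim v fun _ => z) t ∘
      (Sum.elim (fun i => Sum.inl (Sum.inl i)) fun _ => Sum.inr 0 : V ⊕ Unit → (V ⊕ Unit) ⊕ Fin 1))
      = Sum.elim v fun _ => t 0 := by
    intro t; funext x; rcases x with x | x <;> rfl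
  have h2 : ∀ t : Fin 1 → M, (Sum.elim (Sum.elim v fun _ => z) t ∘
      (Sum.elim (fun a : G.params => Sum.inl (Sum.inl (par a)))
        ![Sum.inr 0, Sum.inl (Sum.inr ())] : G.params ⊕ Fin 2 → (V ⊕ Unit) ⊕ Fin 1))
      = Sum.elim (fun a : G.params => (a : M)) ![t 0, z] := by
    intro t; funext x
    rcases x with a | i
    · simp [hv]
    · fin_cases i <;> rfl
  simp only [invG, Formula.realize_iExs, Formula.realize_inf, Formula.realize_relabel, h1, h2,
    G.realize_invF]
  constructor
  · rintro ⟨t, ht, hz⟩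
    rw [(hF _).1 ht, hz]
  · intro h
    exact ⟨fun _ => c, (hF _).2 rfl, h⟩

theorem defines_mulG {v : V → M} (hv : ∀ a, v (par a) = a) {F₁ F₂ : L.Formula (V ⊕ Unit)}
    {c₁ c₂ : M} (hF₁ : Defines F₁ v c₁) (hF₂ : Defines F₂ v c₂) :
    Defines (G.mulG par F₁ F₂) v (G.mul c₁ c₂) := by
  intro z
  have h1 : ∀ (t : Fin 2 → M) (j : Fin 2), (Sum.elim (Sum.elim v fun _ => z) t ∘
      (Sum.elim (fun i => Sum.inl (Sum.inl i)) fun _ => Sum.inr j : V ⊕ Unit → (V ⊕ Unit) ⊕ Fin 2))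
      = Sum.elim v fun _ => t j := by
    intro t j; funext x; rcases x with x | x <;> rfl
  have h2 : ∀ t : Fin 2 → M, (Sum.elim (Sum.elim v fun _ => z) t ∘
      (Sum.elim (fun a : G.params => Sum.inl (Sum.inl (par a)))
        ![Sum.inr 0, Sum.inr 1, Sum.inl (Sum.inr ())] : G.params ⊕ Fin 3 → (V ⊕ Unit) ⊕ Fin 2))
      = Sum.elim (fun a : G.params => (a : M)) ![t 0, t 1, z] := by
    intro t; funext x
    rcases x with a | i
    · simp [hv]
    · fin_cases i <;> rfl
  simp only [mulG, Formula.realize_iExs, Formula.realize_inf, Formula.realize_relabel, h1, h2,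
    G.realize_mulF]
  constructor
  · rintro ⟨t, ht1, ht2, hz⟩
    rw [(hF₁ _).1 ht1, (hF₂ _).1 ht2, hz]
  · intro h
    exact ⟨![c₁, c₂], (hF₁ _).2 rfl, (hF₂ _).2 rfl, h⟩

theorem defines_listProdG {v : V → M} (hv : ∀ a, v (par a) = a)
    {Fs : List (L.Formula (V ⊕ Unit))} {cs : List M}
    (h : List.Forall₂ (fun F c => Defines F v c) Fs cs) :
    Defines (G.listProdG par Fs) v (G.listProd cs) := by
  have key : ∀ {Fs : List (L.Formula (V ⊕ Unit))} {cs : List M},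
      List.Forall₂ (fun F c => Defines F v c) Fs cs → ∀ F c, Defines F v c →
        Defines (Fs.foldl (G.mulG par) F) v (cs.foldl G.mul c) := by
    intro Fs cs h
    induction h with
    | nil => exact fun F c hF => hF
    | cons h1 _ ih => exact fun F c hF => ih _ _ (G.defines_mulG par hv hF h1)
  cases h with
  | nil => exact G.defines_oneG par hv
  | cons h0 h => exact key h _ _ h0

end Formulas

/-! ### The types `q^n` -/

/-- The formula in the variable `x`
`∃ y₀ … y_{2n-1}, ⋀_{ℓ < 2n} ψ(y_ℓ) ∧ ⋀_{ℓ < n, k < m} (φ_k(y_{2ℓ}) ↔ φ_k(y_{2ℓ+1})) ∧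
  x = (y₀⁻¹ * y₁) * ⋯ * (y_{2n-2}⁻¹ * y_{2n-1})`,
where `ψ` is the conjunction of the finite set `Ψ`.  The variable `y_{2ℓ+i}` is indexed by
`(ℓ, i) : Fin n × Fin 2`. -/
noncomputable def qFormula (n : ℕ) (Ψ : Finset (ParamFormula L M)) {m : ℕ}
    (φ : Fin m → ParamFormula L M) : ParamFormula L M :=
  Formula.iExs (Fin n × Fin 2)
    (Formula.iInf (fun i : (Fin n × Fin 2) × Ψ =>
        i.2.1.relabel (Sum.elim (fun b => Sum.inl (Sum.inl b)) fun _ => Sum.inr i.1)) ⊓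
      (Formula.iInf (fun i : Fin n × Fin m =>
          Formula.iff
            ((φ i.2).relabel (Sum.elim (fun b => Sum.inl (Sum.inl b)) fun _ => Sum.inr (i.1, 0)))
            ((φ i.2).relabel (Sum.elim (fun b => Sum.inl (Sum.inl b)) fun _ => Sum.inr (i.1, 1)))) ⊓
        (G.listProdG (V := (M ⊕ Unit) ⊕ (Fin n × Fin 2)) (fun b => Sum.inl (Sum.inl b))
          (List.ofFn fun ℓ : Fin n =>
            G.mulG (fun b => Sum.inl (Sum.inl b))
              (G.invG (fun b => Sum.inl (Sum.inl b)) (varG (Sum.inr (ℓ, 0))))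
              (varG (Sum.inr (ℓ, 1))))).relabel
          (Sum.elim id fun _ => Sum.inl (Sum.inr ()))))

/-- The formula `qFormula` says what it should. -/
theorem holds_qFormula (n : ℕ) (Ψ : Finset (ParamFormula L M)) {m : ℕ}
    (φ : Fin m → ParamFormula L M) (x : M) :
    Holds (G.qFormula n Ψ φ) x ↔ ∃ y : Fin n × Fin 2 → M,
      (∀ i, ∀ ψ ∈ Ψ, Holds ψ (y i)) ∧
      (∀ ℓ k, Holds (φ k) (y (ℓ, 0)) ↔ Holds (φ k) (y (ℓ, 1))) ∧
      x = G.listProd (List.ofFn fun ℓ => G.mul (G.inv (y (ℓ, 0))) (y (ℓ, 1))) := by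
  have h1 : ∀ (y : Fin n × Fin 2 → M) (j : Fin n × Fin 2),
      (Sum.elim (Sum.elim id fun _ => x) y ∘
      (Sum.elim (fun b => Sum.inl (Sum.inl b)) fun _ => Sum.inr j :
        M ⊕ Unit → (M ⊕ Unit) ⊕ (Fin n × Fin 2))) = Sum.elim id fun _ => y j := by
    intro y j; funext t; rcases t with t | t <;> rfl
  have h2 : ∀ y : Fin n × Fin 2 → M, (Sum.elim (Sum.elim id fun _ => x) y ∘
      (Sum.elim id fun _ => Sum.inl (Sum.inr ()) :
        ((M ⊕ Unit) ⊕ (Fin n × Fin 2)) ⊕ Unit → (M ⊕ Unit) ⊕ (Fin n × Fin 2)))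
      = Sum.elim (Sum.elim (Sum.elim id fun _ => x) y) fun _ => x := by
    intro y; funext t; rcases t with t | t <;> rfl
  have h3 : ∀ y : Fin n × Fin 2 → M, Defines
        (G.listProdG (V := (M ⊕ Unit) ⊕ (Fin n × Fin 2)) (fun b => Sum.inl (Sum.inl b))
          (List.ofFn fun ℓ : Fin n =>
            G.mulG (fun b => Sum.inl (Sum.inl b))
              (G.invG (fun b => Sum.inl (Sum.inl b)) (varG (Sum.inr (ℓ, 0))))
              (varG (Sum.inr (ℓ, 1))))) (Sum.elim (Sum.elim id fun _ => x) y)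
        (G.listProd (List.ofFn fun ℓ => G.mul (G.inv (y (ℓ, 0))) (y (ℓ, 1)))) := by
    intro y
    apply G.defines_listProdG
    · intro a; rfl
    · rw [List.forall₂_iff_get]
      refine ⟨by simp, ?_⟩
      intro i hi hi'
      simp only [List.get_ofFn]
      exact G.defines_mulG _ (fun _ => rfl)
        (G.defines_invG _ (fun _ => rfl) (defines_varG _ _)) (defines_varG _ _)
  simp only [Holds, qFormula, Formula.realize_iExs, Formula.realize_inf, Formula.realize_iInf,
    Formula.realize_iff, Formula.realize_relabel, h1, h2, (h3 _ x), Prod.forall, Subtype.forall,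
    eq_comm (a := x)]

/-- The type `q^n_{Γ₁, Γ₂}(x)`. -/
def q (n : ℕ) (Γ₁ Γ₂ : Set (ParamFormula L M)) : Set (ParamFormula L M) :=
  {θ | ∃ (Ψ : Finset (ParamFormula L M)) (m : ℕ) (φ : Fin m → ParamFormula L M),
    (Ψ : Set (ParamFormula L M)) ⊆ Γ₁ ∪ G.pM ∧ (∀ k, φ k ∈ Γ₂) ∧ θ = G.qFormula n Ψ φ}

end TypeDefGroup

section

variable (L : FirstOrder.Language.{u, v}) {M : Type w}

/-- `Γ_a`, the set of all formulas `φ(x, a)` of the language, for a (possibly infinite)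
tuple `a`. -/
def Gam {I : Type*} (a : I → M) : Set (ParamFormula L M) :=
  Set.range fun φ : L.Formula (I ⊕ Unit) => φ.relabel (Sum.map a id)

end

/-- The type `q^n_a(x) = q^n_{∅, Γ_a}(x)`. -/
def TypeDefGroup.qTuple {L : FirstOrder.Language.{u, v}} {M : Type w} [L.Structure M] (G : TypeDefGroup L M)
    {I : Type*} (n : ℕ) (a : I → M) : Set (ParamFormula L M) :=
  G.q n ∅ (Gam L a)

end ShelahDep

namespace ShelahDep

/-! Suppose that no small family of tuples works. Recursion then gives a long sequence of tuples
`a_i` and group elements `b_i` such that `b_j` realizes `q^k_{a_i}` for all `i < j`, while `b_i`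
violates some formula of `q^n_{a_i}`. Up to the tuple, there are fewer than `κ` formulas, so a
single formula is violated along an infinite subsequence.

Such a sequence contradicts dependence (`not_exists_sequence`). For each `N`,
`exists_monochromatic_cube` gives indices `x_i < x'_i` (`i < N`) such that the truth values of the
`φ_t(∏_{i ∈ s} b_{y_i}, a_{y_j})` do not depend on the choice of each `y_i` in `{x_i, x'_i}`. Let
`c_s` be the quotient of `∏_{i ∈ s} b_{x_i}` by `∏_{i ∈ s} b_{x'_i}`. If `j ∉ s`, these products
agree on every `φ_t(·, a_{x_j})`, so `c_s` satisfies the `q^1`-formula at `a_{x_j}`. If `j ∈ s`,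
commutativity gives `b_{x_j} = b_{x'_j} * d * c_s`, where `d` is the opposite quotient over `s \
{j}` and satisfies the `q^1`-formula. If `c_s` satisfied it too, `b_{x_j}` would satisfy the
`q^{k+2}`-formula, hence the `q^n`-formula. So the `c_s` shatter `N` points.

Saturation enters twice: realizations of `q^k` lie in the group (`solutions_qTuple_subset_carrier`),
and inclusion of solution sets is entailment (`entails_of_iInter_solutions_subset`). -/

/-! ### Monochromatic boxes -/

/-- A finite colouring of `ι^N` is constant on the vertices of a nondegenerate box. -/
theorem exists_monochromatic_cube {ι : Type*} [LinearOrder ι] [Infinite ι] (N : ℕ) :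
    ∀ {C : Type} [Finite C] (f : (Fin N → ι) → C), ∃ x x' : Fin N → ι, (∀ i, x i < x' i) ∧
      ∀ s : Set (Fin N), ∀ y : Fin N → ι, (∀ i ∈ s, y i = x' i) → (∀ i ∉ s, y i = x i) →
        f y = f x := by
  induction N with
  | zero =>
    intro C _ f
    exact ⟨Fin.elim0, Fin.elim0, fun i => i.elim0, fun s y _ _ =>
      congrArg f (funext fun i => i.elim0)⟩
  | succ N ih =>
    intro C _ f
    have := Fintype.ofFinite C
    obtain ⟨t, ht⟩ := Infinite.exists_subset_card_eq ι (Fintype.card C + 1)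
    let p := t.orderEmbOfFin ht
    -- The new colour of `y` records the colours over all `|C| + 1` chosen first coordinates at
    -- once; two of these coordinates then share a colour over `x`, and hence over the whole smaller
    -- box.
    obtain ⟨x, x', hx, hc⟩ := ih (fun y (i : Fin (Fintype.card C + 1)) => f (Fin.cons (p i) y))
    obtain ⟨i, j, hij, he⟩ : ∃ i j, i < j ∧ f (Fin.cons (p i) x) = f (Fin.cons (p j) x) := by
      obtain ⟨i, j, hij, he⟩ := Fintype.exists_ne_map_eq_of_card_lt
        (fun i : Fin (Fintype.card C + 1) => f (Fin.cons (p i) x)) (by simp)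
      rcases lt_or_gt_of_ne hij with h | h
      · exact ⟨i, j, h, he⟩
      · exact ⟨j, i, h, he.symm⟩
    refine ⟨Fin.cons (p i) x, Fin.cons (p j) x', ?_, ?_⟩
    · intro k
      refine Fin.cases ?_ (fun k => ?_) k
      · simpa using hij
      · simpa using hx k
    · intro s y h1 h2
      have h3 := hc (Fin.succ ⁻¹' s) (Fin.tail y) (fun k hk => (by simpa using h1 k.succ hk : y k.succ = x' k))
        (fun k hk => (by simpa using h2 k.succ hk : y k.succ = x k))
      by_cases h0 : (0 : Fin (N + 1)) ∈ s
      · have h4 : y = Fin.cons (p j) (Fin.tail y) := by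
          rw [← Fin.cons_self_tail y]; simp [h1 0 h0]
        rw [h4, congrFun h3 j, he]
      · have h4 : y = Fin.cons (p i) (Fin.tail y) := by
          rw [← Fin.cons_self_tail y]; simp [h2 0 h0]
        rw [h4, congrFun h3 i]

/-! ### Saturation and dependence for formulas with parameters -/

section ModelTheory

variable {L : FirstOrder.Language.{u, v}} {M : Type w} [L.Structure M]

open Classical in
/-- The parameters occurring in a formula. -/
noncomputable def ParamFormula.parameters (φ : ParamFormula L M) : Finset M :=
  φ.freeVarFinset.toLeft

theorem exists_liftParams_iff (φ : ParamFormula L M) {A : Set M} (hA : ↑φ.parameters ⊆ A) :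
    ∃ φ' : L.Formula (A ⊕ Unit), ∀ c, Holds (liftParams φ') c ↔ Holds φ c := by
  classical
  have hA' : ∀ b, Sum.inl b ∈ φ.freeVarFinset → b ∈ A := fun b hb =>
    hA (by simpa [ParamFormula.parameters] using hb)
  refine ⟨φ.restrictFreeVar (fun b => match b with
    | ⟨.inl b, hb⟩ => .inl ⟨b, hA' b (by convert hb)⟩
    | ⟨.inr t, _⟩ => .inr t), fun c => ?_⟩
  rw [Holds, liftParams, Formula.realize_relabel]
  refine BoundedFormula.realize_restrictFreeVar _ ?_
  rintro ⟨b | t, hb⟩ <;> rfl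

/-- Each formula mentions finitely many parameters, so fewer than `κ` formulas together use a
parameter set of size below `κ`. -/
theorem IsSaturated.exists_holds {κ : Cardinal.{w}} (hsat : IsSaturated L M κ) (hκ : ℵ₀ < κ)
    {J : Type*} (hJ : lift.{w} #J < lift κ) (θ : J → ParamFormula L M)
    (hθ : ∀ s : Finset J, ∃ c, ∀ j ∈ s, Holds (θ j) c) : ∃ c, ∀ j, Holds (θ j) c := by
  classical
  set A : Set M := ⋃ j, ↑(θ j).parameters with hAdef
  have hA : #A < κ := by
    rw [← lift_lt, hAdef]
    refine (mk_iUnion_le_lift _).trans_lt ?_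
    refine (mul_le_mul_right (c := ℵ₀) (ciSup_le' fun j => ?_) _).trans_lt ?_
    · simp only [lift_le_aleph0]
      exact (lt_aleph0_of_finite _).le
    · exact mul_lt_of_lt (aleph0_le_lift.2 hκ.le) hJ (aleph0_lt_lift.2 hκ)
  choose θ' hθ' using fun j => exists_liftParams_iff (θ j) (A := A)
    (Set.subset_iUnion (fun j => (↑(θ j).parameters : Set M)) j)
  obtain ⟨c, hc⟩ := hsat A hA (Set.range θ') (by
    intro s hs
    obtain ⟨t, -, rfl⟩ := Finset.subset_set_image_iff.1 (Set.image_univ (f := θ') ▸ hs)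
    obtain ⟨c, hc⟩ := hθ t
    refine ⟨c, fun φ hφ => ?_⟩
    obtain ⟨j, hj, rfl⟩ := Finset.mem_image.1 hφ
    exact (hθ' j c).2 (hc j hj))
  exact ⟨c, fun j => (hθ' j c).1 (hc _ ⟨j, rfl⟩)⟩

theorem lift_mk_finset_lt {κ : Cardinal.{w}} (hκ : ℵ₀ < κ) {J : Type*}
    (hJ : lift.{w} #J < lift κ) : lift.{w} #(Finset J) < lift κ := by
  rcases finite_or_infinite J with h | h
  · exact (lift_lt_aleph0.2 (lt_aleph0_of_finite _)).trans (aleph0_lt_lift.2 hκ)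
  · rwa [mk_finset_of_infinite]

/-- The variables are realized one at a time: first an `x` for which every finite subfamily still
has some `y`, then `y` over this `x`. -/
theorem IsSaturated.exists_realize_pair {κ : Cardinal.{w}} (hsat : IsSaturated L M κ)
    (hκ : ℵ₀ < κ) {J : Type*} (hJ : lift.{w} #J < lift κ) (θ : J → L.Formula (M ⊕ Fin 2))
    (hθ : ∀ s : Finset J, ∃ x y, ∀ j ∈ s, (θ j).Realize (Sum.elim id ![x, y])) :
    ∃ x y, ∀ j, (θ j).Realize (Sum.elim id ![x, y]) := by
  classical
  have hfst : ∀ (s : Finset J) (x : M),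
      Holds (Formula.iExs (Fin 1) (Formula.iInf fun j : s => (θ j).relabel
        (Sum.elim (fun b => Sum.inl (Sum.inl b)) ![Sum.inl (Sum.inr ()), Sum.inr 0]))) x ↔
      ∃ y, ∀ j ∈ s, (θ j).Realize (Sum.elim id ![x, y]) := by
    intro s x
    have h : ∀ t : Fin 1 → M, (Sum.elim (Sum.elim id fun _ => x) t ∘
        (Sum.elim (fun b => Sum.inl (Sum.inl b)) ![Sum.inl (Sum.inr ()), Sum.inr 0] :
          M ⊕ Fin 2 → (M ⊕ Unit) ⊕ Fin 1)) = Sum.elim id ![x, t 0] := by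
      intro t; funext b
      rcases b with b | i
      · rfl
      · fin_cases i <;> rfl
    simp only [Holds, Formula.realize_iExs, Formula.realize_iInf, Formula.realize_relabel, h,
      Subtype.forall]
    exact ⟨fun ⟨t, ht⟩ => ⟨t 0, ht⟩, fun ⟨y, hy⟩ => ⟨fun _ => y, hy⟩⟩
  obtain ⟨x, hx⟩ := hsat.exists_holds hκ (lift_mk_finset_lt hκ hJ) _ (fun S => by
    obtain ⟨x, y, h⟩ := hθ (S.biUnion id)
    exact ⟨x, fun s hs => (hfst s x).2 ⟨y, fun j hj => h j (Finset.mem_biUnion.2 ⟨s, hs, hj⟩)⟩⟩)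
  have hsnd : ∀ (j : J) (y : M), Holds ((θ j).relabel
      (Sum.elim Sum.inl ![Sum.inl x, Sum.inr ()]) : ParamFormula L M) y ↔
      (θ j).Realize (Sum.elim id ![x, y]) := by
    intro j y
    rw [Holds, Formula.realize_relabel]
    refine iff_of_eq (congrArg _ (funext ?_))
    rintro (b | i)
    · rfl
    · fin_cases i <;> rfl
  obtain ⟨y, hy⟩ := hsat.exists_holds hκ hJ _ (fun s => by
    obtain ⟨y, hy⟩ := (hfst s x).1 (hx s)
    exact ⟨y, fun j hj => (hsnd j y).2 (hy j hj)⟩)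
  exact ⟨x, y, fun j => (hsnd j y).1 (hy j)⟩

theorem mk_formula_lt {κ : Cardinal.{w}} (hκ : ℵ₀ < κ)
    (hL : lift.{w} L.card < lift.{max u v} κ) {V : Type w} (hV : #V < κ) :
    #(L.Formula V) < lift.{max u v} κ := by
  have h1 : #(L.Formula V) ≤ #(Σ n, L.BoundedFormula V n) :=
    mk_le_of_injective (f := fun φ : L.Formula V => (⟨0, φ⟩ : Σ n, L.BoundedFormula V n))
      (fun φ ψ h => by simpa using h)
  refine (h1.trans BoundedFormula.card_le).trans_lt (max_lt ?_ ?_)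
  · simpa using hκ
  · refine add_lt_of_lt (by simpa using hκ.le) ?_ ?_
    · simpa using hV
    · simpa using hL

/-- In a dependent theory, instances of a formula with infinitely many parameter variables do not
shatter arbitrarily large finite sets. -/
theorem IsDependent.not_forall_shatters [Nonempty M] {T : L.Theory}
    (hdep : IsDependent.{u, v, w} T) (hM : M ⊨ T) {V : Type*} (θ : L.Formula (V ⊕ Unit)) :
    ¬ ∀ N : ℕ, ∃ (a : Fin N → V → M) (b : Set (Fin N) → M), ∀ (i : Fin N) (s : Set (Fin N)),
      θ.Realize (Sum.elim (a i) fun _ => b s) ↔ i ∈ s := by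
  classical
  intro h
  -- Only the finitely many variables from `V` that occur in `θ` matter; numbering them yields a
  -- formula to which `hdep` applies.
  let F : Finset V := θ.freeVarFinset.toLeft
  have hF : ∀ b, Sum.inl b ∈ θ.freeVarFinset → b ∈ F := fun b hb => by simpa [F] using hb
  let φ : L.Formula (Fin F.card ⊕ Fin 1) := θ.restrictFreeVar (fun b => match b with
    | ⟨.inl b, hb⟩ => .inl (F.equivFin ⟨b, hF b (by convert hb)⟩)
    | ⟨.inr _, _⟩ => .inr 0)
  refine hdep M hM _ _ φ fun N => ?_
  obtain ⟨a, b, hab⟩ := h N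
  refine ⟨fun i k => a i (F.equivFin.symm k), fun s _ => b s, fun i s => ?_⟩
  rw [← hab]
  refine BoundedFormula.realize_restrictFreeVar _ ?_
  rintro ⟨b | t, hb⟩ <;> simp

end ModelTheory

end ShelahDep

theorem eq_mul_mul_inv_mul {A : Type*} [CommGroup A] (x x' y y' : A) :
    x' = y' * (x⁻¹ * y) * ((y' * y)⁻¹ * (x' * x)) := by
  rw [mul_comm x' x, mul_comm x⁻¹ y, ← mul_assoc y', mul_assoc (y' * y), mul_comm x⁻¹,
    mul_assoc _ (x * x'), mul_assoc x, mul_comm x' x⁻¹, mul_inv_cancel_left, mul_inv_cancel_left]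

namespace ShelahDep.TypeDefGroup

variable {L : FirstOrder.Language.{u, v}} {M : Type w} [L.Structure M] (G : TypeDefGroup L M)

/-! ### The group on the set of realizations -/

/-- The group of realizations of `p_*`, if it is abelian. -/
abbrev commGroup (hG : G.IsAbelian) : CommGroup G.carrier where
  mul x y := ⟨G.mul x y, G.mul_mem x x.2 y y.2⟩
  one := ⟨G.one, G.one_mem⟩
  inv x := ⟨G.inv x, G.inv_mem x x.2⟩
  mul_assoc x y z := Subtype.ext (G.mul_assoc x x.2 y y.2 z z.2)
  one_mul x := Subtype.ext (G.one_mul x x.2)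
  mul_one x := Subtype.ext (G.mul_one x x.2)
  inv_mul_cancel x := Subtype.ext (G.inv_mul x x.2)
  mul_comm x y := Subtype.ext (hG x x.2 y y.2)

theorem listProd_append {d : M} (hd : d ∈ G.carrier) (l l' : List M) :
    G.listProd (l ++ d :: l') = l'.foldl G.mul (G.mul (G.listProd l) d) := by
  cases l with
  | nil => simp [listProd, G.one_mul d hd]
  | cons c l => simp [listProd]

theorem foldl_mul_replicate_one {z : M} (hz : z ∈ G.carrier) (r : ℕ) :
    (List.replicate r G.one).foldl G.mul z = z := by
  induction r with
  | zero => rfl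
  | succ r ih => rw [List.replicate_succ, List.foldl_cons, G.mul_one z hz, ih]

/-! ### The formulas `qFormula` in terms of lists -/

/-- With lists of pairs as witnesses, products of realizations correspond to concatenation. -/
theorem holds_qFormula_iff_exists_list (n : ℕ) (Ψ : Finset (ParamFormula L M)) {m : ℕ}
    (φ : Fin m → ParamFormula L M) (x : M) :
    Holds (G.qFormula n Ψ φ) x ↔ ∃ l : List (M × M), l.length = n ∧
      (∀ y ∈ l, (∀ ψ ∈ Ψ, Holds ψ y.1 ∧ Holds ψ y.2) ∧
        ∀ k, Holds (φ k) y.1 ↔ Holds (φ k) y.2) ∧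
      x = G.listProd (l.map fun y => G.mul (G.inv y.1) y.2) := by
  rw [holds_qFormula]
  constructor
  · rintro ⟨y, h1, h2, h3⟩
    refine ⟨List.ofFn fun ℓ => (y (ℓ, 0), y (ℓ, 1)), by simp, ?_, by
      rw [h3, List.map_ofFn]; rfl⟩
    intro z hz
    obtain ⟨ℓ, rfl⟩ := (List.mem_ofFn' _ _).1 hz
    exact ⟨fun ψ hψ => ⟨h1 _ ψ hψ, h1 _ ψ hψ⟩, h2 ℓ⟩
  · rintro ⟨l, rfl, h1, h2⟩
    refine ⟨fun i => ![(l.get i.1).1, (l.get i.1).2] i.2, ?_, ?_, ?_⟩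
    · rintro ⟨ℓ, i⟩ ψ hψ
      have := (h1 _ (l.get_mem ℓ)).1 ψ hψ
      fin_cases i
      · exact this.1
      · exact this.2
    · exact fun ℓ => (h1 _ (l.get_mem ℓ)).2
    · rw [h2]
      congr 1
      conv_lhs => rw [← List.ofFn_get l, List.map_ofFn]
      rfl

theorem holds_qFormula_one (Ψ : Finset (ParamFormula L M)) {m : ℕ}
    (φ : Fin m → ParamFormula L M) (x : M) :
    Holds (G.qFormula 1 Ψ φ) x ↔ ∃ y₀ y₁ : M, ((∀ ψ ∈ Ψ, Holds ψ y₀ ∧ Holds ψ y₁) ∧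
      ∀ k, Holds (φ k) y₀ ↔ Holds (φ k) y₁) ∧ x = G.mul (G.inv y₀) y₁ := by
  rw [holds_qFormula_iff_exists_list]
  constructor
  · rintro ⟨l, hl, h1, h2⟩
    obtain ⟨y, rfl⟩ := List.length_eq_one_iff.1 hl
    exact ⟨y.1, y.2, h1 y (by simp), h2⟩
  · rintro ⟨y₀, y₁, h, rfl⟩
    exact ⟨[(y₀, y₁)], rfl, by simpa using h, rfl⟩

theorem holds_of_mem_carrier {Ψ : Finset (ParamFormula L M)} (hΨ : ↑Ψ ⊆ G.pM) {x y : M}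
    (hx : x ∈ G.carrier) (hy : y ∈ G.carrier) : ∀ ψ ∈ Ψ, Holds ψ x ∧ Holds ψ y :=
  fun ψ hψ => ⟨hx ψ (hΨ hψ), hy ψ (hΨ hψ)⟩

/-- Multiplying a realization of `qFormula k` in the group by two more differences, the second of
which need only be a difference of elements near the group. -/
theorem holds_qFormula_of_mul {k n m : ℕ} (hkn : k + 2 ≤ n) {Ψ : Finset (ParamFormula L M)}
    (hΨ : ↑Ψ ⊆ G.pM) {φ : Fin m → ParamFormula L M} {b d e : M} (hb : b ∈ G.carrier)
    (hbk : Holds (G.qFormula k Ψ φ) b) (hd : d ∈ G.carrier) (hd1 : Holds (G.qFormula 1 Ψ φ) d)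
    (he1 : Holds (G.qFormula 1 Ψ φ) e) :
    Holds (G.qFormula n Ψ φ) (G.mul (G.mul b d) e) := by
  obtain ⟨l, rfl, hl, hbl⟩ := (G.holds_qFormula_iff_exists_list _ _ _ _).1 hbk
  obtain ⟨d₀, d₁, hd', rfl⟩ := (G.holds_qFormula_one _ _ _).1 hd1
  obtain ⟨e₀, e₁, he', rfl⟩ := (G.holds_qFormula_one _ _ _).1 he1
  obtain ⟨r, rfl⟩ := Nat.exists_eq_add_of_le hkn
  -- The trivial pairs that pad the length to `n` come before `(e₀, e₁)`: there the partial product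
  -- is `b * d`, known to lie in the group, so multiplying by `G.one` does not change it.
  refine (G.holds_qFormula_iff_exists_list _ _ _ _).2
    ⟨l ++ (d₀, d₁) :: (List.replicate r (G.one, G.one) ++ [(e₀, e₁)]), ?_, ?_, ?_⟩
  · simp; omega
  · intro y hy
    rw [List.mem_append, List.mem_cons, List.mem_append, List.mem_singleton] at hy
    rcases hy with hy | rfl | hy | rfl
    · exact hl y hy
    · exact hd'
    · rw [List.eq_of_mem_replicate hy]
      exact ⟨G.holds_of_mem_carrier hΨ G.one_mem G.one_mem, fun _ => Iff.rfl⟩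
    · exact he'
  · rw [List.map_append, List.map_cons, G.listProd_append hd, ← hbl, List.map_append,
      List.map_replicate, List.foldl_append, G.inv_mul _ G.one_mem,
      G.foldl_mul_replicate_one (G.mul_mem b hb _ hd)]
    rfl

/-- The formula `qFormula 1` with the parameters of the `φ k` turned into variables. -/
theorem exists_realize_iff_holds_qFormula_one {I : Type*} (Ψ : Finset (ParamFormula L M)) {m : ℕ}
    (φ : Fin m → L.Formula (I ⊕ Unit)) : ∃ θ : L.Formula ((I ⊕ M) ⊕ Unit),
      ∀ (a : I → M) (x : M), θ.Realize (Sum.elim (Sum.elim a id) fun _ => x) ↔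
        Holds (G.qFormula 1 Ψ fun k => (φ k).relabel (Sum.map a id)) x := by
  let par : M → ((I ⊕ M) ⊕ Unit) ⊕ Fin 2 := fun b => Sum.inl (Sum.inl (Sum.inr b))
  refine ⟨Formula.iExs (Fin 2) (Formula.iInf (fun i : Fin 2 × Ψ =>
      i.2.1.relabel (Sum.elim par fun _ => Sum.inr i.1)) ⊓
    (Formula.iInf (fun k : Fin m =>
      Formula.iff
        ((φ k).relabel (Sum.elim (fun b => Sum.inl (Sum.inl (Sum.inl b))) fun _ => Sum.inr 0))
        ((φ k).relabel (Sum.elim (fun b => Sum.inl (Sum.inl (Sum.inl b))) fun _ => Sum.inr 1))) ⊓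
      (G.mulG par (G.invG par (varG (Sum.inr 0))) (varG (Sum.inr 1))).relabel
        (Sum.elim id fun _ => Sum.inl (Sum.inr ())))), fun a x => ?_⟩
  have h1 : ∀ (y : Fin 2 → M) (j : Fin 2),
      (Sum.elim (Sum.elim (Sum.elim a id) fun _ => x) y ∘
      (Sum.elim par fun _ : Unit => Sum.inr j)) = Sum.elim id fun _ => y j := by
    intro y j; funext t; rcases t with t | t <;> rfl
  have h2 : ∀ (y : Fin 2 → M) (j : Fin 2),
      (Sum.elim (Sum.elim (Sum.elim a id) fun _ : Unit => x) y ∘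
      (Sum.elim (fun b => Sum.inl (Sum.inl (Sum.inl b))) fun _ : Unit => Sum.inr j)) =
        Sum.elim id (fun _ => y j) ∘ Sum.map a id := by
    intro y j; funext t; rcases t with t | t <;> rfl
  have h3 : ∀ y : Fin 2 → M, (Sum.elim (Sum.elim (Sum.elim a id) fun _ : Unit => x) y ∘
      (Sum.elim id fun _ : Unit => Sum.inl (Sum.inr ())))
      = Sum.elim (Sum.elim (Sum.elim (Sum.elim a id) fun _ : Unit => x) y) fun _ => x := by
    intro y; funext t; rcases t with t | t <;> rfl
  have h4 : ∀ y : Fin 2 → M, Defines (G.mulG par (G.invG par (varG (Sum.inr 0)))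
      (varG (Sum.inr 1))) (Sum.elim (Sum.elim (Sum.elim a id) fun _ => x) y)
      (G.mul (G.inv (y 0)) (y 1)) := fun y =>
    G.defines_mulG _ (fun _ => rfl) (G.defines_invG _ (fun _ => rfl) (defines_varG _ _))
      (defines_varG _ _)
  rw [holds_qFormula_one]
  simp only [Formula.realize_iExs, Formula.realize_inf, Formula.realize_iInf,
    Formula.realize_iff, Formula.realize_relabel, h1, h2, h3, h4 _ x, Holds, Prod.forall,
    Subtype.forall, Fin.forall_fin_two, eq_comm (a := x)]
  constructor
  · rintro ⟨y, ⟨h0, h1⟩, h⟩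
    exact ⟨y 0, y 1, ⟨fun ψ hψ => ⟨h0 ψ hψ, h1 ψ hψ⟩, h.1⟩, h.2⟩
  · rintro ⟨y₀, y₁, ⟨h0, h1⟩, h⟩
    exact ⟨![y₀, y₁], ⟨fun ψ hψ => (h0 ψ hψ).1, fun ψ hψ => (h0 ψ hψ).2⟩, h1, h⟩

/-! ### The combinatorial core -/

/-- Quotients of products of the `b i` over the two ends of a monochromatic box make the negated
`q^1`-formula shatter sets of every finite size. -/
theorem not_exists_sequence [Nonempty M] {T : L.Theory} (hdep : IsDependent.{u, v, w} T)
    (hM : M ⊨ T) (hG : G.IsAbelian) {k n : ℕ} (hkn : k + 2 ≤ n) {I ι : Type*} [LinearOrder ι]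
    [Infinite ι] {Ψ : Finset (ParamFormula L M)} (hΨ : ↑Ψ ⊆ G.pM) {m : ℕ}
    (φ : Fin m → L.Formula (I ⊕ Unit)) (a : ι → I → M) (b : ι → M) (hb : ∀ i, b i ∈ G.carrier)
    (hk : ∀ i j, i < j → Holds (G.qFormula k Ψ fun t => (φ t).relabel (Sum.map (a i) id)) (b j))
    (hn : ∀ i, ¬ Holds (G.qFormula n Ψ fun t => (φ t).relabel (Sum.map (a i) id)) (b i)) :
    False := by
  classical
  let := G.commGroup hG
  obtain ⟨θ, hθ⟩ := G.exists_realize_iff_holds_qFormula_one Ψ φ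
  -- The negation is taken because `c s` will satisfy the `q^1`-formula at `a (x j)` exactly when `j
  -- ∉ s`.
  refine hdep.not_forall_shatters hM θ.not fun N => ?_
  let β : ι → G.carrier := fun i => ⟨b i, hb i⟩
  obtain ⟨x, x', hx, hcube⟩ := exists_monochromatic_cube (ι := ι) N
    (C := Finset (Fin N) → Fin N → Fin m → Prop) (fun y s j t =>
      Holds ((φ t).relabel (Sum.map (a (y j)) id)) (∏ i ∈ s, β (y i) : G.carrier))
  have hq : ∀ (s : Finset (Fin N)) (j), j ∉ s →
      ∀ t, (Holds ((φ t).relabel (Sum.map (a (x j)) id)) (∏ i ∈ s, β (x' i) : G.carrier) ↔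
        Holds ((φ t).relabel (Sum.map (a (x j)) id)) (∏ i ∈ s, β (x i) : G.carrier)) := by
    intro s j hj t
    -- At this vertex every factor with index in `s` moves to its upper end, while the tuple `a (x
    -- j)` stays put because `j ∉ s`.
    have h := hcube s (fun i => if i ∈ s then x' i else x i)
      (fun i hi => if_pos hi) (fun i hi => if_neg hi)
    have h' := congrFun (congrFun (congrFun h s) j) t
    simp only [if_neg hj] at h'
    rw [Finset.prod_congr rfl (fun i hi => by rw [if_pos hi] : ∀ i ∈ s,
      β (if i ∈ s then x' i else x i) = β (x' i))] at h'
    exact iff_of_eq h'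
  let c : Finset (Fin N) → G.carrier := fun s => (∏ i ∈ s, β (x' i))⁻¹ * ∏ i ∈ s, β (x i)
  refine ⟨fun i => Sum.elim (a (x i)) id, fun s => c s.toFinset, fun j s => ?_⟩
  rw [Formula.realize_not, hθ, ← Set.mem_toFinset]
  beta_reduce
  generalize s.toFinset = s
  constructor
  · intro h
    by_contra hj
    exact h ((G.holds_qFormula_one _ _ _).2 ⟨_, _,
      ⟨G.holds_of_mem_carrier hΨ (Subtype.property _) (Subtype.property _), hq s j hj⟩, rfl⟩)
  · intro hj h
    let d : G.carrier := (∏ i ∈ s.erase j, β (x i))⁻¹ * ∏ i ∈ s.erase j, β (x' i)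
    have hd : Holds (G.qFormula 1 Ψ fun t => (φ t).relabel (Sum.map (a (x j)) id)) (d : M) :=
      (G.holds_qFormula_one _ _ _).2 ⟨_, _,
        ⟨G.holds_of_mem_carrier hΨ (Subtype.property _) (Subtype.property _),
          fun t => (hq _ j (Finset.notMem_erase j s) t).symm⟩, rfl⟩
    have hbj : β (x j) = β (x' j) * d * c s := by
      simp only [c, d, ← Finset.mul_prod_erase s _ hj]
      generalize ∏ i ∈ s.erase j, β (x i) = y
      generalize ∏ i ∈ s.erase j, β (x' i) = z
      generalize β (x j) = y'
      generalize β (x' j) = z'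
      exact eq_mul_mul_inv_mul y y' z z'
    refine hn (x j) ?_
    -- Here `x j < x' j` matters: it makes the later element `b (x' j)` satisfy the `q^k`-formula at
    -- the earlier tuple `a (x j)`.
    have := G.holds_qFormula_of_mul hkn hΨ (hb (x' j)) (hk _ _ (hx j)) d.2 hd h
    rwa [show b (x j) = G.mul (G.mul (b (x' j)) d) (c s) from congrArg Subtype.val hbj]

end ShelahDep.TypeDefGroup

namespace ShelahDep.TypeDefGroup

variable {L : FirstOrder.Language.{u, v}} {M : Type w} [L.Structure M] (G : TypeDefGroup L M)

/-! ### Cardinality bounds -/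

theorem lift_mk_lt_lift {κ : Cardinal.{w}} {J : Type max u w}
    (hJ : #J < lift.{u} κ) : lift.{w} #J < lift.{max u w} κ := by
  have h := lift_lt.{_, w}.2 hJ
  rwa [lift_lift] at h

theorem mk_option_lt {c : Cardinal.{w}} (hc : ℵ₀ ≤ c) {J : Type w} (hJ : #J < c) :
    #(Option J) < c := by
  rw [mk_option]
  exact add_lt_of_lt hc hJ (one_lt_aleph0.trans_le hc)

theorem mk_pM_lt {κ : Cardinal.{w}} (hκ : ℵ₀ < κ)
    (hL : lift.{w} L.card < lift.{max u v} κ) (hA : #G.params < κ) :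
    #G.pM < lift.{max u v} κ := by
  have hV : #(G.params ⊕ Unit) < κ := by
    rw [mk_sum]
    refine add_lt_of_lt hκ.le (by simpa using hA) (by simpa using one_lt_aleph0.trans hκ)
  exact (mk_image_le.trans (mk_set_le _)).trans_lt (mk_formula_lt hκ hL hV)

/-! ### Solutions of the types `q^n` lie in the group -/

/-- Compactness: otherwise saturation would give a pair in the group whose image under `f` violates
`Ψ₀`. This controls `f` on elements that only satisfy finitely many formulas of the type, as the
witnesses in `qFormula` do. -/
theorem exists_finset_closed {κ : Cardinal.{w}} (hsat : IsSaturated L M κ) (hκ : ℵ₀ < κ)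
    (hp : #G.pM < lift.{max u v} κ) {f : M → M → M} (F : L.Formula ((M ⊕ Fin 2) ⊕ Unit))
    (hF : ∀ x y, Defines F (Sum.elim id ![x, y]) (f x y))
    (hf : ∀ x ∈ G.carrier, ∀ y ∈ G.carrier, f x y ∈ G.carrier)
    (Ψ₀ : Finset (ParamFormula L M)) (hΨ₀ : ↑Ψ₀ ⊆ G.pM) :
    ∃ Ψ : Finset (ParamFormula L M), ↑Ψ ⊆ G.pM ∧ ∀ x y, (∀ ψ ∈ Ψ, Holds ψ x) →
      (∀ ψ ∈ Ψ, Holds ψ y) → ∀ ψ ∈ Ψ₀, Holds ψ (f x y) := by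
  classical
  by_contra! hcon
  let F₀ : L.Formula (M ⊕ Fin 2) := Formula.iExs (Fin 1)
    (F.relabel (Sum.elim Sum.inl fun _ => Sum.inr 0) ⊓
      Formula.iInf fun ψ : Ψ₀ => ψ.1.relabel
        (Sum.elim (fun b => Sum.inl (Sum.inl b)) fun _ => Sum.inr 0))
  have hF₀ : ∀ x y, F₀.Realize (Sum.elim id ![x, y]) ↔ ∀ ψ ∈ Ψ₀, Holds ψ (f x y) := by
    intro x y
    have h1 : ∀ t : Fin 1 → M, (Sum.elim (Sum.elim id ![x, y]) t ∘
        (Sum.elim Sum.inl fun _ : Unit => Sum.inr 0)) =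
          Sum.elim (Sum.elim id ![x, y]) fun _ => t 0 := by
      intro t; funext b; rcases b with b | b <;> rfl
    have h2 : ∀ t : Fin 1 → M, (Sum.elim (Sum.elim id ![x, y]) t ∘
        (Sum.elim (fun b => Sum.inl (Sum.inl b)) fun _ : Unit => Sum.inr 0)) =
          Sum.elim id fun _ => t 0 := by
      intro t; funext b; rcases b with b | b <;> rfl
    simp only [F₀, Formula.realize_iExs, Formula.realize_inf, Formula.realize_iInf,
      Formula.realize_relabel, h1, h2, hF x y _, Subtype.forall, Holds]
    exact ⟨fun ⟨t, ht, h⟩ => ht ▸ h, fun h => ⟨fun _ => f x y, rfl, h⟩⟩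
  have hpair : ∀ (ψ : ParamFormula L M) (i : Fin 2) (x y : M),
      (ψ.relabel (Sum.elim Sum.inl fun _ => Sum.inr i) : L.Formula (M ⊕ Fin 2)).Realize
        (Sum.elim id ![x, y]) ↔ Holds ψ (![x, y] i) := by
    intro ψ i x y
    rw [Formula.realize_relabel, Holds]
    refine iff_of_eq (congrArg _ (funext ?_))
    rintro (b | b) <;> rfl
  let θ : Option G.pM → L.Formula (M ⊕ Fin 2) := fun j => j.elim F₀.not fun ψ =>
    ψ.1.relabel (Sum.elim Sum.inl fun _ => Sum.inr 0) ⊓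
      ψ.1.relabel (Sum.elim Sum.inl fun _ => Sum.inr 1)
  obtain ⟨x, y, hxy⟩ := hsat.exists_realize_pair hκ
    (lift_mk_lt_lift.{max u v, w} (mk_option_lt (by simpa using hκ.le) hp)) θ (fun s => by
      obtain ⟨x, y, hx, hy, ψ, hψ, h⟩ := hcon ((s.eraseNone).map (Function.Embedding.subtype _))
        (by intro ψ hψ; simp at hψ; exact hψ.1)
      refine ⟨x, y, fun j hj => ?_⟩
      rcases j with _ | j
      · exact fun h' => h ((hF₀ x y).1 h' ψ hψ)
      · have hj' : j.1 ∈ (s.eraseNone).map (Function.Embedding.subtype _) :=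
          Finset.mem_map_of_mem _ (by simpa using hj)
        exact Formula.realize_inf.2 ⟨(hpair _ _ _ _).2 (hx _ hj'), (hpair _ _ _ _).2 (hy _ hj')⟩)
  have h0 := hxy none
  refine h0 ((hF₀ x y).2 fun ψ hψ => hf x (fun ψ hψ => ?_) y (fun ψ hψ => ?_) ψ (hΨ₀ hψ))
  · exact (hpair _ _ _ _).1 (Formula.realize_inf.1 (hxy (some ⟨ψ, hψ⟩))).1
  · exact (hpair _ _ _ _).1 (Formula.realize_inf.1 (hxy (some ⟨ψ, hψ⟩))).2

theorem exists_finset_mul {κ : Cardinal.{w}} (hsat : IsSaturated L M κ) (hκ : ℵ₀ < κ)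
    (hp : #G.pM < lift.{max u v} κ) (Ψ₀ : Finset (ParamFormula L M)) (hΨ₀ : ↑Ψ₀ ⊆ G.pM) :
    ∃ Ψ : Finset (ParamFormula L M), ↑Ψ ⊆ G.pM ∧ ∀ x y, (∀ ψ ∈ Ψ, Holds ψ x) →
      (∀ ψ ∈ Ψ, Holds ψ y) → ∀ ψ ∈ Ψ₀, Holds ψ (G.mul x y) :=
  G.exists_finset_closed hsat hκ hp
    (G.mulG Sum.inl (varG (Sum.inr 0)) (varG (Sum.inr 1)))
    (fun _ _ => G.defines_mulG _ (fun _ => rfl) (defines_varG _ _) (defines_varG _ _))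
    G.mul_mem Ψ₀ hΨ₀

theorem exists_finset_inv_mul {κ : Cardinal.{w}} (hsat : IsSaturated L M κ) (hκ : ℵ₀ < κ)
    (hp : #G.pM < lift.{max u v} κ) (Ψ₀ : Finset (ParamFormula L M)) (hΨ₀ : ↑Ψ₀ ⊆ G.pM) :
    ∃ Ψ : Finset (ParamFormula L M), ↑Ψ ⊆ G.pM ∧ ∀ x y, (∀ ψ ∈ Ψ, Holds ψ x) →
      (∀ ψ ∈ Ψ, Holds ψ y) → ∀ ψ ∈ Ψ₀, Holds ψ (G.mul (G.inv x) y) :=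
  G.exists_finset_closed hsat hκ hp
    (G.mulG Sum.inl (G.invG Sum.inl (varG (Sum.inr 0))) (varG (Sum.inr 1)))
    (fun _ _ => G.defines_mulG _ (fun _ => rfl)
      (G.defines_invG _ (fun _ => rfl) (defines_varG _ _)) (defines_varG _ _))
    (fun x hx y hy => G.mul_mem _ (G.inv_mem x hx) y hy) Ψ₀ hΨ₀

theorem exists_finset_foldl {κ : Cardinal.{w}} (hsat : IsSaturated L M κ) (hκ : ℵ₀ < κ)
    (hp : #G.pM < lift.{max u v} κ) (n : ℕ) (Ψ₀ : Finset (ParamFormula L M)) (hΨ₀ : ↑Ψ₀ ⊆ G.pM) :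
    ∃ Ψ : Finset (ParamFormula L M), ↑Ψ ⊆ G.pM ∧ ∀ (l : List M) (z : M), l.length = n →
      (∀ ψ ∈ Ψ, Holds ψ z) → (∀ x ∈ l, ∀ ψ ∈ Ψ, Holds ψ x) →
        ∀ ψ ∈ Ψ₀, Holds ψ (l.foldl G.mul z) := by
  classical
  induction n with
  | zero =>
    refine ⟨Ψ₀, hΨ₀, fun l z hl hz _ => ?_⟩
    rwa [List.length_eq_zero_iff.1 hl]
  | succ n ih =>
    obtain ⟨Ψ₁, hΨ₁, h₁⟩ := ih
    obtain ⟨Ψ₂, hΨ₂, h₂⟩ := G.exists_finset_mul hsat hκ hp Ψ₁ hΨ₁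
    refine ⟨Ψ₁ ∪ Ψ₂, by simp [hΨ₁, hΨ₂], fun l z hl hz hx => ?_⟩
    obtain ⟨x, l, rfl⟩ := List.exists_cons_of_length_eq_add_one hl
    exact h₁ l _ (by simpa using hl)
      (h₂ z x (fun ψ hψ => hz ψ (Finset.mem_union_right _ hψ))
        fun ψ hψ => hx x (by simp) ψ (Finset.mem_union_right _ hψ))
      fun y hy ψ hψ => hx y (by simp [hy]) ψ (Finset.mem_union_left _ hψ)

/-- For each `ψ` of the group type, a strong enough finite condition on the factors forces `ψ` on
the product; the witnesses may vary with `ψ`. -/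
theorem solutions_qTuple_subset_carrier {κ : Cardinal.{w}} (hsat : IsSaturated L M κ)
    (hκ : ℵ₀ < κ) (hp : #G.pM < lift.{max u v} κ) {I : Type*} (n : ℕ) (a : I → M) :
    solutions (G.qTuple n a) ⊆ G.carrier := by
  intro b hb ψ hψ
  have hb' : ∀ Ψ : Finset (ParamFormula L M), ↑Ψ ⊆ G.pM →
      Holds (G.qFormula n Ψ (Fin.elim0 : Fin 0 → ParamFormula L M)) b := fun Ψ hΨ =>
    hb _ ⟨Ψ, 0, Fin.elim0, hΨ.trans Set.subset_union_right, fun k => k.elim0, rfl⟩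
  have hψ' : ((({ψ} : Finset (ParamFormula L M)) : Set (ParamFormula L M))) ⊆ G.pM := by
    simpa using hψ
  -- The fold starts at the first factor, leaving `n - 1` more; for `n = 0` the product is `G.one`
  -- and this choice plays no role.
  obtain ⟨Ψ₁, hΨ₁, h₁⟩ := G.exists_finset_foldl hsat hκ hp (n - 1) {ψ} hψ'
  obtain ⟨Ψ₂, hΨ₂, h₂⟩ := G.exists_finset_inv_mul hsat hκ hp Ψ₁ hΨ₁
  obtain ⟨l, hl, hl', rfl⟩ := (G.holds_qFormula_iff_exists_list _ _ _ _).1 (hb' Ψ₂ hΨ₂)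
  have hmem : ∀ y ∈ l, ∀ ψ ∈ Ψ₁, Holds ψ (G.mul (G.inv y.1) y.2) := fun y hy =>
    h₂ _ _ (fun ψ hψ => ((hl' y hy).1 ψ hψ).1) fun ψ hψ => ((hl' y hy).1 ψ hψ).2
  cases l with
  | nil => exact G.one_mem ψ hψ
  | cons y l =>
    refine h₁ _ _ (by simp [← hl]) (hmem y (by simp)) ?_ ψ (by simp)
    intro x hx
    obtain ⟨y, hy, rfl⟩ := List.mem_map.1 hx
    exact hmem y (by simp [hy])

/-! ### Enumerating the types `q^n` -/

/-- The data specifying a formula of `q^n_a`, up to the tuple `a`. -/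
abbrev QIndex (I : Type w) : Type max u v w :=
  Finset G.pM × Σ m : ℕ, Fin m → L.Formula (I ⊕ Unit)

/-- The formula of `q^n_a` with given data. -/
noncomputable def qIndexed {I : Type w} (n : ℕ) (a : I → M) (d : G.QIndex I) : ParamFormula L M :=
  G.qFormula n (d.1.map (Function.Embedding.subtype _)) fun k =>
    (d.2.2 k).relabel (Sum.map a id)

theorem mem_qTuple_iff {I : Type w} (n : ℕ) (a : I → M) (θ : ParamFormula L M) :
    θ ∈ G.qTuple n a ↔ ∃ d, θ = G.qIndexed n a d := by
  classical
  constructor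
  · rintro ⟨Ψ, m, φ, hΨ, hφ, rfl⟩
    choose φ' hφ' using hφ
    refine ⟨⟨Ψ.subtype (· ∈ G.pM), m, φ'⟩, ?_⟩
    have h1 : (Ψ.subtype (· ∈ G.pM)).map (Function.Embedding.subtype _) = Ψ :=
      Finset.subtype_map_of_mem fun ψ hψ => by simpa using hΨ hψ
    have h2 : φ = fun k => (φ' k).relabel (Sum.map a id) := funext fun k => (hφ' k).symm
    rw [qIndexed, h1, h2]
  · rintro ⟨d, rfl⟩
    refine ⟨_, _, _, ?_, fun k => ⟨d.2.2 k, rfl⟩, rfl⟩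
    intro ψ hψ
    simp at hψ
    exact Or.inr hψ.1

theorem mk_qIndex_lt {κ : Cardinal.{w}} (hκ : ℵ₀ < κ)
    (hL : lift.{w} L.card < lift.{max u v} κ) (hp : #G.pM < lift.{max u v} κ) {I : Type w}
    (hI : #I < κ) : #(G.QIndex I) < lift.{max u v} κ := by
  have hV : #(I ⊕ Unit) < κ := by
    rw [mk_sum]
    refine add_lt_of_lt hκ.le (by simpa using hI) (by simpa using one_lt_aleph0.trans hκ)
  have hκ' : ℵ₀ < lift.{max u v} κ := by simpa using hκ
  rw [mk_prod, lift_id, lift_id]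
  refine mul_lt_of_lt hκ'.le ?_ ?_
  · rcases finite_or_infinite G.pM with h | h
    · exact (lt_aleph0_of_finite _).trans hκ'
    · rwa [mk_finset_of_infinite]
  · rw [← (List.equivSigmaTuple (α := L.Formula (I ⊕ Unit))).cardinal_eq]
    exact (mk_list_le_max _).trans_lt (max_lt hκ' (mk_formula_lt hκ hL hV))

/-! ### The main result -/

/-- If every small `S` failed, choosing counterexamples recursively and thinning by pigeonhole would
produce the sequence excluded by `not_exists_sequence`. -/
theorem exists_set_iInter_solutions_subset [Nonempty M] {κ : Cardinal.{w}} (hκ : κ.IsInaccessible)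
    (hL : lift.{w} L.card < lift.{max u v} κ) {T : L.Theory} (hM : M ⊨ T)
    (hsat : IsSaturated L M κ) (hdep : IsDependent.{u, v, w} T) (hA : #G.params < κ)
    (hG : G.IsAbelian) {k n : ℕ} (hkn : k + 2 ≤ n) {I : Type w} (hI : #I < κ) :
    ∃ S : Set (I → M), #S < κ ∧ ∀ a : I → M,
      (⋂ t ∈ S, solutions (G.qTuple k t)) ⊆ solutions (G.qTuple n a) := by
  have hp := G.mk_pM_lt hκ.aleph0_lt hL hA
  by_contra! hcon
  have hstep : ∀ S : Set (I → M), ∃ e : (I → M) × M × G.QIndex I, #S < κ →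
      (∀ t ∈ S, e.2.1 ∈ solutions (G.qTuple k t)) ∧ ¬ Holds (G.qIndexed n e.1 e.2.2) e.2.1 := by
    intro S
    by_cases hS : #S < κ
    · obtain ⟨a, ha⟩ := hcon S hS
      obtain ⟨b, hb, hb'⟩ := Set.not_subset.1 ha
      simp only [solutions, Set.mem_ofPred_eq, not_forall] at hb'
      obtain ⟨θ, hθ, hb'⟩ := hb'
      obtain ⟨d, rfl⟩ := (G.mem_qTuple_iff _ _ _).1 hθ
      exact ⟨⟨a, b, d⟩, fun _ => ⟨by simpa using hb, hb'⟩⟩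
    · exact ⟨⟨fun _ => Classical.arbitrary M, Classical.arbitrary M, ∅, 0, Fin.elim0⟩,
        fun h => absurd h hS⟩
  choose e he using hstep
  obtain ⟨δ, hδ, hδ'⟩ := lt_lift_iff.1 (G.mk_qIndex_lt hκ.aleph0_lt hL hp hI)
  -- Long enough to exceed the number `δ` of formula indices, yet below the limit cardinal `κ`, so
  -- every initial segment of the recursion is small.
  set μ := Order.succ (max δ ℵ₀)
  have hμκ : μ < κ := hκ.isSuccLimit.succ_lt (max_lt hδ hκ.aleph0_lt)
  have hμ₀ : ℵ₀ ≤ μ := (le_max_right _ _).trans (Order.le_succ _)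
  -- Adding `t₀` at every stage keeps the family nonempty, so that even the first element chosen
  -- realizes some `q^k` and hence lies in the group.
  let t₀ : I → M := fun _ => Classical.arbitrary M
  let s : μ.ord.ToType → (I → M) × M × G.QIndex I := wellFounded_lt.fix fun i s =>
    e (insert t₀ (Set.range fun j : Set.Iio i => (s j.1 j.2).1))
  have hs : ∀ i, s i = e (insert t₀ (Set.range fun j : Set.Iio i => (s j.1).1)) := fun i =>
    wellFounded_lt.fix_eq _ i
  have hcard : ∀ i, #(insert t₀ (Set.range fun j : Set.Iio i => (s j.1).1) : Set (I → M)) < κ := by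
    intro i
    refine mk_insert_le.trans_lt (add_lt_of_lt hκ.aleph0_lt.le ?_
      (one_lt_aleph0.trans hκ.aleph0_lt))
    exact mk_range_le.trans_lt ((mk_Iio_lt i (by simp)).trans (by rwa [mk_ord_toType]))
  have hs1 : ∀ i, (s i).2.1 ∈ G.carrier := fun i =>
    G.solutions_qTuple_subset_carrier hsat hκ.aleph0_lt hp k t₀
      (by rw [hs i]; exact (he _ (hcard i)).1 t₀ (Set.mem_insert _ _))
  have hs2 : ∀ i j, i < j → (s j).2.1 ∈ solutions (G.qTuple k (s i).1) := fun i j hij => by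
    rw [hs j]
    exact (he _ (hcard j)).1 _ (Set.mem_insert_of_mem _ ⟨⟨i, hij⟩, rfl⟩)
  have hs3 : ∀ i, ¬ Holds (G.qIndexed n (s i).1 (s i).2.2) (s i).2.1 := fun i => by
    rw [hs i]
    exact (he _ (hcard i)).2
  have : Infinite μ.ord.ToType := by
    rwa [infinite_iff, mk_ord_toType]
  obtain ⟨d, hd⟩ := exists_infinite_fiber
    (fun i : ULift.{max u v} μ.ord.ToType => (s i.down).2.2) (by
      rw [mk_uLift, mk_ord_toType, ← hδ', lift_lt]
      exact (le_max_left _ _).trans_lt (Order.lt_succ _))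
  let ι := {i : μ.ord.ToType // (s i).2.2 = d}
  have : Infinite ι := hd.of_injective
    (fun i => (⟨i.1.down, i.2⟩ : ι)) (fun i j h => Subtype.ext (ULift.ext _ _
      (congrArg Subtype.val h)))
  refine G.not_exists_sequence hdep hM hG hkn (ι := ι)
    (Ψ := d.1.map (Function.Embedding.subtype _)) ?_ d.2.2 (fun i => (s i).1)
    (fun i => (s i).2.1) (fun i => hs1 i) ?_ ?_
  · intro ψ hψ
    simp at hψ
    exact hψ.1
  · exact fun i j hij => hs2 i j hij _ ((G.mem_qTuple_iff _ _ _).2 ⟨d, rfl⟩)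
  · intro i
    have h := hs3 i
    rwa [i.2] at h

/-- In a saturated model, an inclusion between sets of solutions is an entailment. -/
theorem entails_of_iInter_solutions_subset {κ : Cardinal.{w}} (hsat : IsSaturated L M κ)
    (hκ : ℵ₀ < κ) {I E : Type w} (hI : #(G.QIndex I) < lift.{max u v} κ) (hE : #E < κ)
    {k n : ℕ} {t : E → I → M} {a : I → M}
    (h : (⋂ ε, solutions (G.qTuple k (t ε))) ⊆ solutions (G.qTuple n a)) :
    Entails (⋃ ε, G.qTuple k (t ε)) (G.qTuple n a) := by
  classical
  intro φ hφ
  by_contra! hcon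
  have hκ' : ℵ₀ < lift.{max u v} κ := by simpa using hκ
  have hJ : #(Option (E × G.QIndex I)) < lift.{max u v} κ := by
    refine mk_option_lt hκ'.le ?_
    rw [mk_prod]
    refine mul_lt_of_lt hκ'.le ?_ ?_
    · rw [show lift.{max u v w, w} #E = lift.{max u v} #E from congrFun lift_umax.{w, max u v} _]
      exact lift_lt.2 hE
    · rwa [lift_id'.{w, max u v w}]
  let θ : E × G.QIndex I → ParamFormula L M := fun j => G.qIndexed k (t j.1) j.2
  -- The index `none` stands for the negation of `φ`; a common realization would lie in the
  -- intersection but fail `φ`.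
  obtain ⟨c, hc⟩ := hsat.exists_holds hκ (lift_mk_lt_lift.{max u v, w} hJ)
    (fun j => j.elim φ.not θ) (fun s => by
      obtain ⟨c, hc, hc'⟩ := hcon (s.eraseNone.image θ) (by
        intro ψ hψ
        obtain ⟨j, -, rfl⟩ := Finset.mem_image.1 hψ
        exact Set.mem_iUnion.2 ⟨j.1, (G.mem_qTuple_iff _ _ _).2 ⟨j.2, rfl⟩⟩)
      refine ⟨c, fun j hj => ?_⟩
      rcases j with _ | j
      · exact hc'
      · exact hc _ (Finset.mem_image_of_mem _ (by simpa using hj)))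
  refine hc none (h (Set.mem_iInter.2 fun ε ψ hψ => ?_) φ hφ)
  obtain ⟨d, rfl⟩ := (G.mem_qTuple_iff _ _ _).1 hψ
  exact hc (some (ε, d))

end ShelahDep.TypeDefGroup

theorem claim1p7 {L : FirstOrder.Language.{u, v}} {M : Type w} [L.Structure M] [Nonempty M]
    (κ : Cardinal.{w}) (hκ : κ.IsInaccessible)
    (hL : Cardinal.lift.{w} L.card < Cardinal.lift.{max u v} κ)
    (T : L.Theory) (hT : T.IsComplete) (hM : M ⊨ T)
    (hsat : ShelahDep.IsSaturated L M κ)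
    (hdep : ShelahDep.IsDependent.{u, v, w} T)
    (G : ShelahDep.TypeDefGroup L M) (hA : Cardinal.mk G.params < κ) (hG : G.IsAbelian)
    (k₁ k₂ : ℕ) (hk : k₁ + 2 < k₂) (α : Ordinal.{w}) (hα : α < κ.ord) :
    ∃ lam : Cardinal.{w}, lam < κ ∧ ∃ aε : lam.ord.ToType → (α.ToType → M),
      ∀ a : α.ToType → M, G.params ⊆ Set.range a →
        (⋂ ε, ShelahDep.solutions (G.qTuple k₁ (aε ε))) ⊆
            ShelahDep.solutions (G.qTuple k₂ a) ∧
          ShelahDep.Entails (⋃ ε, G.qTuple k₁ (aε ε)) (G.qTuple k₂ a) := by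
  have hI : #α.ToType < κ := by
    rw [mk_toType]
    exact lt_ord.1 hα
  obtain ⟨S, hS, h⟩ :=
    G.exists_set_iInter_solutions_subset hκ hL hM hsat hdep hA hG (Nat.le_of_lt hk) hI
  obtain ⟨f⟩ : Nonempty ((#S).ord.ToType ≃ S) := Cardinal.eq.1 (mk_ord_toType _)
  refine ⟨#S, hS, fun ε => (f ε).1, fun a _ => ?_⟩
  have hsub : (⋂ ε, ShelahDep.solutions (G.qTuple k₁ (f ε).1)) ⊆
      ShelahDep.solutions (G.qTuple k₂ a) := by
    refine Set.Subset.trans (fun c hc => Set.mem_iInter₂.2 fun t ht => ?_) (h a)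
    simpa using Set.mem_iInter.1 hc (f.symm ⟨t, ht⟩)
  exact ⟨hsub, G.entails_of_iInter_solutions_subset hsat hκ.aleph0_lt
    (G.mk_qIndex_lt hκ.aleph0_lt hL (G.mk_pM_lt hκ.aleph0_lt hL hA) hI)
    (by rwa [mk_ord_toType]) hsub⟩
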